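/- Let $\alpha = (1+\sqrt5)/2$. Define $\delta_1 = 1$ and, for $k \ge 1$, $\delta_{2k} = 1$ and $\delta_{2k+1} = 0$. The EFC array $(E_{i,j})_{i,j\ge1}$ of Kimberling is the array defined row by row as follows: $E_{i,1}$ is the smallest positive integer that does not appear in any of the rows $1,\dots,i-1$; $E_{i,2} = \lfloor \alpha E_{i,1} \rfloor + \delta_i$; and $E_{i,j} = E_{i,j-1} + E_{i,j-2}$ for $j \ge 3$. Then for all $n \ge 1$ we have $$E_{2n,1} = 2\lfloor n\alpha\rfloor + 2n, \qquad E_{2n+1,1} = 2\lfloor n\alpha\rfloor + 2n + 2.$$ Hence $E_{2n,1}$ is even for all $n \ge 1$; more generally, $E_{i,1}$ is even for all $i \ge 2$. -/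

import Mathlib

namespace Stolarsky

/-- The generalized Fibonacci sequence, indexed from `1`: its first two terms are `a` and `b`, and
each later term is the sum of the two preceding ones. (The value at index `0` is never used.) -/
def genFib (a b : ℕ) : ℕ → ℕ
  | 0 => 0
  | 1 => a
  | 2 => b
  | n + 3 => genFib a b (n + 2) + genFib a b (n + 1)

/-- The row with first entry `a` and classification number `d`: it is the generalized Fibonacci
sequence with first term `a` and second term `⌊α a⌋ + d`, where `α` is the golden ratio. -/
noncomputable def row (d a : ℕ) (j : ℕ) : ℕ :=
  genFib a (⌊Real.goldenRatio * (a : ℝ)⌋₊ + d) j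

/-- The first column of the array with classification sequence `δ` (rows indexed from `1`): its
`i`-th entry is the least positive integer that appears in none of the rows `1, …, i - 1`. -/
noncomputable def firstColumn (δ : ℕ → ℕ) (i : ℕ) : ℕ :=
  sInf {x : ℕ | 1 ≤ x ∧
    ∀ i' : ℕ, ∀ _h : i' < i, 1 ≤ i' → ∀ j : ℕ, 1 ≤ j → x ≠ row (δ i') (firstColumn δ i') j}
termination_by i

/-- The array `A i j` (`i, j ≥ 1`) with classification sequence `δ`: the first entry of each row is
the least positive integer that appears in no preceding row, the second entry is
`A i 2 = ⌊α * A i 1⌋ + δ i`, and `A i j = A i (j - 1) + A i (j - 2)` for `j ≥ 3`. -/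
noncomputable def array (δ : ℕ → ℕ) (i j : ℕ) : ℕ :=
  row (δ i) (firstColumn δ i) j

/-- The classification sequence of the EFC array: `δ 1 = 1`, and `δ (2 * k) = 1`,
`δ (2 * k + 1) = 0` for `k ≥ 1`. (The value at index `0` is never used.) -/
def efcDelta (i : ℕ) : ℕ :=
  if i = 1 ∨ Even i then 1 else 0

/-- Kimberling's EFC (even first column) array `E i j`, `i, j ≥ 1`. -/
noncomputable def E (i j : ℕ) : ℕ :=
  array efcDelta i j

/-- The first column satisfies the minimal-excluded-element rule. -/
theorem array_one (δ : ℕ → ℕ) (i : ℕ) :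
    array δ i 1 = sInf {x : ℕ | 1 ≤ x ∧
      ∀ i' : ℕ, i' < i → 1 ≤ i' → ∀ j : ℕ, 1 ≤ j → x ≠ array δ i' j} := by
  change firstColumn δ i = _
  rw [firstColumn]
  rfl

theorem array_two (δ : ℕ → ℕ) (i : ℕ) :
    array δ i 2 = ⌊Real.goldenRatio * (array δ i 1 : ℝ)⌋₊ + δ i := rfl

theorem array_add_three (δ : ℕ → ℕ) (i n : ℕ) :
    array δ i (n + 3) = array δ i (n + 2) + array δ i (n + 1) := rfl

end Stolarsky

namespace Stolarsky

open Real

/-! Write a(m) = ⌊mα⌋, b(m) = a(m) + m, c(m) = `nextHalf m` = a(b(m) + 1). The choice of δ makes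
each row from the second on begin 2m, 2a(m) + 1; the recurrence continues it with 2b(m) + 1, 2c(m),
2a(c(m)) + 1, and so on (`IsConsecutive.next`). Row 1 is the same pattern entered at 1, 2 with m =
0. So every entry after the first of a row is odd or of the form 2c(k). Applying Beatty's theorem
twice, every m ≥ 1 is some b(n) or b(n) + 1 with n ≥ 1, or some c(k), and c(k) never meets the other
two kinds. Hence 2b(n) and 2(b(n) + 1) must start rows, while all other integers above 1 occur later
in a row. As first entries increase and rows are nondecreasing, the least-missing-integer rule picks
exactly these. -/

/-- The lower Wythoff sequence `⌊m α⌋`. -/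
noncomputable def lowerWythoff (m : ℕ) : ℕ := ⌊(m : ℝ) * goldenRatio⌋₊

/-- The upper Wythoff sequence `⌊m α²⌋ = ⌊m α⌋ + m`. -/
noncomputable def upperWythoff (m : ℕ) : ℕ := lowerWythoff m + m

/-- If a row has the consecutive entries `2 * m` and `2 * ⌊m α⌋ + 1`, then its next even entry is
`2 * nextHalf m`. -/
noncomputable def nextHalf (m : ℕ) : ℕ := m + 2 * lowerWythoff m + 1

/-! ### Floor identities for the Wythoff sequences. -/

theorem three_halves_lt_goldenRatio : 3 / 2 < goldenRatio := by
  nlinarith [goldenRatio_sq, goldenRatio_pos]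

theorem lowerWythoff_le (m : ℕ) : (lowerWythoff m : ℝ) ≤ m * goldenRatio :=
  Nat.floor_le (by have := goldenRatio_pos; positivity)

theorem lt_lowerWythoff_add_one (m : ℕ) : m * goldenRatio < (lowerWythoff m : ℝ) + 1 :=
  Nat.lt_floor_add_one _

theorem floor_eq_of_le_of_lt {x : ℝ} {k : ℕ} (h₁ : (k : ℝ) ≤ x) (h₂ : x < k + 1) : ⌊x⌋₊ = k :=
  (Nat.floor_eq_iff ((Nat.cast_nonneg k).trans h₁)).2 ⟨h₁, h₂⟩

theorem lowerWythoff_zero : lowerWythoff 0 = 0 := by simp [lowerWythoff]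

theorem lowerWythoff_one : lowerWythoff 1 = 1 :=
  floor_eq_of_le_of_lt (by push_cast; linarith [one_lt_goldenRatio])
    (by push_cast; linarith [goldenRatio_lt_two])

theorem lowerWythoff_strictMono : StrictMono lowerWythoff := by
  refine strictMono_nat_of_lt_succ fun n => ?_
  have h₁ := lowerWythoff_le n
  have h₂ := lt_lowerWythoff_add_one (n + 1)
  have h : (lowerWythoff n : ℝ) < lowerWythoff (n + 1) := by
    push_cast at h₂
    linarith [one_lt_goldenRatio]
  exact_mod_cast h

theorem upperWythoff_strictMono : StrictMono upperWythoff :=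
  lowerWythoff_strictMono.add strictMono_id

/-- With x = nα - a(n) in [0, 1), α² = α + 1 gives (a(n) + 1)α = b(n) + α - x(α - 1), which lies in
(b(n) + 1, b(n) + 2). The identities below use the same substitution. -/
theorem lowerWythoff_lowerWythoff_add_one (n : ℕ) :
    lowerWythoff (lowerWythoff n + 1) = upperWythoff n + 1 := by
  have h₁ := lowerWythoff_le n
  have h₂ := lt_lowerWythoff_add_one n
  have hsq : (n : ℝ) * goldenRatio ^ 2 = n * goldenRatio + n := by rw [goldenRatio_sq]; ring
  apply floor_eq_of_le_of_lt <;> simp only [upperWythoff] <;> push_cast <;>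
    nlinarith [one_lt_goldenRatio, goldenRatio_lt_two,
      mul_nonneg (sub_nonneg.2 h₁) (sub_nonneg.2 one_lt_goldenRatio.le),
      mul_nonneg (sub_nonneg.2 h₂.le) (sub_nonneg.2 one_lt_goldenRatio.le)]

theorem lowerWythoff_upperWythoff_add_one (n : ℕ) :
    lowerWythoff (upperWythoff n + 1) = nextHalf n := by
  have h₁ := lowerWythoff_le n
  have h₂ := lt_lowerWythoff_add_one n
  have hsq : (n : ℝ) * goldenRatio ^ 2 = n * goldenRatio + n := by rw [goldenRatio_sq]; ring
  apply floor_eq_of_le_of_lt <;> simp only [upperWythoff, nextHalf] <;> push_cast <;>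
    nlinarith [one_lt_goldenRatio, goldenRatio_lt_two,
      mul_nonneg (sub_nonneg.2 h₁) (sub_nonneg.2 goldenRatio_lt_two.le),
      mul_pos (sub_pos.2 h₂) (sub_pos.2 goldenRatio_lt_two)]

theorem lowerWythoff_upperWythoff (n : ℕ) :
    lowerWythoff (upperWythoff n) = n + 2 * lowerWythoff n := by
  have h₁ := lowerWythoff_le n
  have h₂ := lt_lowerWythoff_add_one n
  have hsq : (n : ℝ) * goldenRatio ^ 2 = n * goldenRatio + n := by rw [goldenRatio_sq]; ring
  apply floor_eq_of_le_of_lt <;> simp only [upperWythoff] <;> push_cast <;>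
    nlinarith [one_lt_goldenRatio, goldenRatio_lt_two,
      mul_nonneg (sub_nonneg.2 h₁) (sub_nonneg.2 goldenRatio_lt_two.le),
      mul_pos (sub_pos.2 h₂) (sub_pos.2 goldenRatio_lt_two)]

theorem lowerWythoff_nextHalf (n : ℕ) :
    lowerWythoff (nextHalf n) = 2 * n + 3 * lowerWythoff n + 1 := by
  have h₁ := lowerWythoff_le n
  have h₂ := lt_lowerWythoff_add_one n
  have hsq : (n : ℝ) * goldenRatio ^ 2 = n * goldenRatio + n := by rw [goldenRatio_sq]; ring
  have h₃ := three_halves_lt_goldenRatio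
  apply floor_eq_of_le_of_lt <;> simp only [nextHalf] <;> push_cast <;>
    nlinarith [goldenRatio_lt_two,
      mul_nonneg (sub_nonneg.2 h₁) (sub_nonneg.2 h₃.le),
      mul_pos (sub_pos.2 h₂) (sub_pos.2 h₃)]

/-- The excess 2x(2 - α) stays below 1 because α > 3/2, so the floor is even and δ = 1 makes the
second entry odd. For `upperWythoff n + 1` the extra 2α > 3 already makes the floor odd, so δ = 0
suffices. -/
theorem floor_goldenRatio_mul_two_mul_upperWythoff (n : ℕ) :
    ⌊goldenRatio * ((2 * upperWythoff n : ℕ) : ℝ)⌋₊ = 2 * lowerWythoff (upperWythoff n) := by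
  have h₁ := lowerWythoff_le n
  have h₂ := lt_lowerWythoff_add_one n
  have hsq : (n : ℝ) * goldenRatio ^ 2 = n * goldenRatio + n := by rw [goldenRatio_sq]; ring
  have h₃ := three_halves_lt_goldenRatio
  rw [lowerWythoff_upperWythoff]
  apply floor_eq_of_le_of_lt <;> simp only [upperWythoff] <;> push_cast <;>
    nlinarith [goldenRatio_lt_two,
      mul_nonneg (sub_nonneg.2 h₁) (sub_nonneg.2 goldenRatio_lt_two.le),
      mul_pos (sub_pos.2 h₂) (sub_pos.2 goldenRatio_lt_two)]

theorem floor_goldenRatio_mul_two_mul_upperWythoff_add_one (n : ℕ) :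
    ⌊goldenRatio * ((2 * (upperWythoff n + 1) : ℕ) : ℝ)⌋₊ =
      2 * lowerWythoff (upperWythoff n + 1) + 1 := by
  have h₁ := lowerWythoff_le n
  have h₂ := lt_lowerWythoff_add_one n
  have hsq : (n : ℝ) * goldenRatio ^ 2 = n * goldenRatio + n := by rw [goldenRatio_sq]; ring
  have h₃ := three_halves_lt_goldenRatio
  rw [lowerWythoff_upperWythoff_add_one]
  apply floor_eq_of_le_of_lt <;> simp only [upperWythoff, nextHalf] <;> push_cast <;>
    nlinarith [goldenRatio_lt_two,
      mul_nonneg (sub_nonneg.2 h₁) (sub_nonneg.2 goldenRatio_lt_two.le),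
      mul_pos (sub_pos.2 h₂) (sub_pos.2 goldenRatio_lt_two)]

/-! ### Beatty partition and its refinement into three classes. -/

theorem holderConjugate_goldenRatio : goldenRatio.HolderConjugate (goldenRatio + 1) := by
  have h := goldenRatio_sq
  have h₀ := goldenRatio_ne_zero
  have h₁ : goldenRatio + 1 ≠ 0 := by linarith [goldenRatio_pos]
  refine Real.holderConjugate_iff.2 ⟨one_lt_goldenRatio, ?_⟩
  rw [inv_add_inv h₀ h₁, div_eq_one_iff_eq (mul_ne_zero h₀ h₁)]
  linear_combination -h

theorem beattySeq_goldenRatio (m : ℕ) : beattySeq goldenRatio m = lowerWythoff m := by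
  rw [beattySeq, Int.cast_natCast, lowerWythoff, Int.natCast_floor_eq_floor]
  have := goldenRatio_pos
  positivity

theorem beattySeq_goldenRatio_add_one (m : ℕ) :
    beattySeq (goldenRatio + 1) m = upperWythoff m := by
  have h := beattySeq_goldenRatio m
  rw [beattySeq, Int.cast_natCast] at h ⊢
  rw [mul_add, mul_one, Int.floor_add_natCast, h, upperWythoff]
  push_cast
  rfl

theorem setOf_beattySeq_pos {r : ℝ} {f : ℕ → ℕ} (h : ∀ m : ℕ, beattySeq r m = f m) (t : ℕ) :
    (t : ℤ) ∈ {beattySeq r k | k > 0} ↔ ∃ m, 1 ≤ m ∧ t = f m := by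
  constructor
  · rintro ⟨k, hk, hkt⟩
    lift k to ℕ using hk.le
    exact ⟨k, by omega, by rw [h] at hkt; omega⟩
  · rintro ⟨m, hm, rfl⟩
    exact ⟨m, by omega, h m⟩

theorem wythoff_xor {t : ℕ} (ht : 1 ≤ t) :
    Xor (∃ m, 1 ≤ m ∧ t = lowerWythoff m) (∃ m, 1 ≤ m ∧ t = upperWythoff m) := by
  have h := Irrational.beattySeq_symmDiff_beattySeq_pos holderConjugate_goldenRatio
    goldenRatio_irrational
  have h' := (Set.ext_iff.1 h (t : ℤ)).2 (show (0 : ℤ) < t by omega)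
  rw [Set.mem_symmDiff, setOf_beattySeq_pos beattySeq_goldenRatio,
    setOf_beattySeq_pos beattySeq_goldenRatio_add_one] at h'
  exact h'

theorem lowerWythoff_ne_upperWythoff {m n : ℕ} (hm : 1 ≤ m) :
    lowerWythoff m ≠ upperWythoff n := by
  intro h
  have h₀ : 1 ≤ lowerWythoff m := hm.trans (lowerWythoff_strictMono.le_apply)
  have hn : 1 ≤ n := by
    by_contra! hn
    obtain rfl : n = 0 := by omega
    simp only [upperWythoff, lowerWythoff_zero] at h
    omega
  rcases wythoff_xor h₀ with ⟨-, h'⟩ | ⟨-, h'⟩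
  · exact h' ⟨n, hn, h⟩
  · exact h' ⟨m, hm, rfl⟩

theorem nextHalf_ne_upperWythoff (k n : ℕ) : nextHalf k ≠ upperWythoff n := by
  rw [← lowerWythoff_upperWythoff_add_one]
  exact lowerWythoff_ne_upperWythoff (by omega)

/-- Both sides are values of a, at b(k) + 1 and a(n) + 1. The case n = 0 must be excluded, since
c(0) = 1 = b(0) + 1. -/
theorem nextHalf_ne_upperWythoff_add_one (k : ℕ) {n : ℕ} (hn : 1 ≤ n) :
    nextHalf k ≠ upperWythoff n + 1 := by
  rw [← lowerWythoff_upperWythoff_add_one, ← lowerWythoff_lowerWythoff_add_one n]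
  intro h
  have h' := lowerWythoff_strictMono.injective h
  exact lowerWythoff_ne_upperWythoff (n := k) hn (by omega)

theorem exists_eq_upperWythoff_or_nextHalf {m : ℕ} (hm : 1 ≤ m) :
    (∃ n, 1 ≤ n ∧ m = upperWythoff n) ∨ (∃ n, 1 ≤ n ∧ m = upperWythoff n + 1) ∨
      ∃ k, m = nextHalf k := by
  rcases Xor.or (wythoff_xor hm) with ⟨j, hj, rfl⟩ | h
  · right
    -- Here m = a(j + 1); the partition is applied again, to the shifted index j.
    obtain ⟨j, rfl⟩ : ∃ i, j = i + 1 := ⟨j - 1, by omega⟩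
    rcases Nat.eq_zero_or_pos j with rfl | hj'
    · exact Or.inr ⟨0, by simp [nextHalf, lowerWythoff_zero, lowerWythoff_one]⟩
    rcases Xor.or (wythoff_xor hj') with ⟨n, hn, rfl⟩ | ⟨n, hn, rfl⟩
    · exact Or.inl ⟨n, hn, lowerWythoff_lowerWythoff_add_one n⟩
    · exact Or.inr ⟨n, lowerWythoff_upperWythoff_add_one n⟩
  · exact Or.inl h

/-! ### The candidate first column and its rows. -/

/-- The closed form of the first column of the EFC array. -/
noncomputable def efcFirst (i : ℕ) : ℕ :=
  if i ≤ 1 then 1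
  else if Even i then 2 * upperWythoff (i / 2) else 2 * (upperWythoff (i / 2) + 1)

/-- The row of the EFC array with first entry `efcFirst i`. -/
noncomputable def efcRow (i j : ℕ) : ℕ := row (efcDelta i) (efcFirst i) j

theorem efcFirst_one : efcFirst 1 = 1 := rfl

theorem efcFirst_two_mul {n : ℕ} (hn : 1 ≤ n) : efcFirst (2 * n) = 2 * upperWythoff n := by
  rw [efcFirst, if_neg (by omega), if_pos (even_two_mul n), Nat.mul_div_cancel_left n two_pos]

theorem efcFirst_two_mul_add_one {n : ℕ} (hn : 1 ≤ n) :
    efcFirst (2 * n + 1) = 2 * (upperWythoff n + 1) := by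
  rw [efcFirst, if_neg (by omega), if_neg (by simp), show (2 * n + 1) / 2 = n by omega]

theorem eq_one_or_two_mul_or {i : ℕ} (hi : 1 ≤ i) :
    i = 1 ∨ (∃ n, 1 ≤ n ∧ i = 2 * n) ∨ ∃ n, 1 ≤ n ∧ i = 2 * n + 1 := by
  rcases Nat.even_or_odd' i with ⟨n, rfl | rfl⟩
  · exact Or.inr (Or.inl ⟨n, by omega, rfl⟩)
  · rcases Nat.eq_zero_or_pos n with rfl | hn
    · exact Or.inl rfl
    · exact Or.inr (Or.inr ⟨n, hn, rfl⟩)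

theorem efcFirst_lt_succ {i : ℕ} (hi : 1 ≤ i) : efcFirst i < efcFirst (i + 1) := by
  rcases eq_one_or_two_mul_or hi with rfl | ⟨n, hn, rfl⟩ | ⟨n, hn, rfl⟩
  · rw [efcFirst_one, show 1 + 1 = 2 * 1 from rfl, efcFirst_two_mul le_rfl]
    have := upperWythoff_strictMono.le_apply (x := 1)
    omega
  · rw [efcFirst_two_mul hn, efcFirst_two_mul_add_one hn]
    omega
  · rw [efcFirst_two_mul_add_one hn, show 2 * n + 1 + 1 = 2 * (n + 1) by ring,
      efcFirst_two_mul (by omega)]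
    have : lowerWythoff n < lowerWythoff (n + 1) := lowerWythoff_strictMono (by omega)
    simp only [upperWythoff]
    omega

theorem efcFirst_lt {i j : ℕ} (hi : 1 ≤ i) (hij : i < j) : efcFirst i < efcFirst j := by
  induction j, hij using Nat.le_induction with
  | base => exact efcFirst_lt_succ hi
  | succ j hj ih => exact ih.trans (efcFirst_lt_succ (by omega))

theorem efcRow_one (i : ℕ) : efcRow i 1 = efcFirst i := rfl

theorem efcRow_add_three (i j : ℕ) : efcRow i (j + 3) = efcRow i (j + 2) + efcRow i (j + 1) := rfl

theorem efcRow_one_two : efcRow 1 2 = 2 := by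
  have : ⌊goldenRatio * ((1 : ℕ) : ℝ)⌋₊ = 1 := by
    rw [mul_comm]
    exact lowerWythoff_one
  simp [efcRow, row, genFib, efcFirst_one, efcDelta] at this ⊢
  omega

theorem efcRow_two_mul_two {n : ℕ} (hn : 1 ≤ n) :
    efcRow (2 * n) 2 = 2 * lowerWythoff (upperWythoff n) + 1 := by
  rw [efcRow, efcFirst_two_mul hn, row, genFib, floor_goldenRatio_mul_two_mul_upperWythoff,
    efcDelta, if_pos (Or.inr (even_two_mul n))]

theorem efcRow_two_mul_add_one_two {n : ℕ} (hn : 1 ≤ n) :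
    efcRow (2 * n + 1) 2 = 2 * lowerWythoff (upperWythoff n + 1) + 1 := by
  rw [efcRow, efcFirst_two_mul_add_one hn, row, genFib,
    floor_goldenRatio_mul_two_mul_upperWythoff_add_one, efcDelta, if_neg, add_zero]
  rintro (h | h)
  · omega
  · simp at h

/-! ### Parity pattern along a row. -/

/-- The three shapes of a pair of consecutive entries of a row. -/
inductive IsConsecutive : ℕ → ℕ → Prop
  | evenOdd (m : ℕ) : IsConsecutive (2 * m) (2 * lowerWythoff m + 1)
  | oddOdd (m : ℕ) : IsConsecutive (2 * lowerWythoff m + 1) (2 * upperWythoff m + 1)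
  | oddEven (m : ℕ) : IsConsecutive (2 * upperWythoff m + 1) (2 * nextHalf m)

theorem IsConsecutive.next {a b : ℕ} (h : IsConsecutive a b) : IsConsecutive b (b + a) := by
  cases h with
  | evenOdd m =>
    convert IsConsecutive.oddOdd m using 1
    simp only [upperWythoff]
    ring
  | oddOdd m =>
    convert IsConsecutive.oddEven m using 1
    simp only [upperWythoff, nextHalf]
    ring
  | oddEven m =>
    convert IsConsecutive.evenOdd (nextHalf m) using 1
    rw [lowerWythoff_nextHalf]
    simp only [upperWythoff, nextHalf]
    ring

theorem isConsecutive_efcRow {i : ℕ} (hi : 1 ≤ i) (j : ℕ) :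
    IsConsecutive (efcRow i (j + 1)) (efcRow i (j + 2)) := by
  induction j with
  | zero =>
    simp only [zero_add, efcRow_one]
    rcases eq_one_or_two_mul_or hi with rfl | ⟨n, hn, rfl⟩ | ⟨n, hn, rfl⟩
    · rw [efcFirst_one, efcRow_one_two]
      simpa [upperWythoff, nextHalf, lowerWythoff_zero] using IsConsecutive.oddEven 0
    · rw [efcFirst_two_mul hn, efcRow_two_mul_two hn]
      exact .evenOdd _
    · rw [efcFirst_two_mul_add_one hn, efcRow_two_mul_add_one_two hn]
      exact .evenOdd _
  | succ j ih => exact ih.next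

theorem odd_or_nextHalf_efcRow {i : ℕ} (hi : 1 ≤ i) (j : ℕ) :
    Odd (efcRow i (j + 2)) ∨ ∃ k, efcRow i (j + 2) = 2 * nextHalf k := by
  have h := isConsecutive_efcRow hi j
  generalize efcRow i (j + 1) = a, efcRow i (j + 2) = b at h
  cases h with
  | evenOdd m => exact Or.inl ⟨_, rfl⟩
  | oddOdd m => exact Or.inl ⟨_, rfl⟩
  | oddEven m => exact Or.inr ⟨m, rfl⟩

theorem efcFirst_ne_odd_or_nextHalf {i x : ℕ} (hi : 2 ≤ i)
    (hx : Odd x ∨ ∃ k, x = 2 * nextHalf k) : efcFirst i ≠ x := by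
  rcases eq_one_or_two_mul_or (by omega : 1 ≤ i) with rfl | ⟨n, hn, rfl⟩ | ⟨n, hn, rfl⟩
  · omega
  · rw [efcFirst_two_mul hn]
    rcases hx with ⟨t, rfl⟩ | ⟨k, rfl⟩
    · omega
    · have := nextHalf_ne_upperWythoff k n
      omega
  · rw [efcFirst_two_mul_add_one hn]
    rcases hx with ⟨t, rfl⟩ | ⟨k, rfl⟩
    · omega
    · have := nextHalf_ne_upperWythoff_add_one k hn
      omega

theorem efcFirst_ne_efcRow {i i' j : ℕ} (hi' : 1 ≤ i') (h : i' < i) (hj : 1 ≤ j) :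
    efcFirst i ≠ efcRow i' j := by
  obtain rfl | ⟨j, rfl⟩ : j = 1 ∨ ∃ k, j = k + 2 := by
    rcases j with _ | _ | j
    · omega
    · exact Or.inl rfl
    · exact Or.inr ⟨j, rfl⟩
  · exact (efcFirst_lt hi' h).ne'
  · exact efcFirst_ne_odd_or_nextHalf (by omega) (odd_or_nextHalf_efcRow hi' j)

/-! ### Every positive integer occurs. -/

theorem exists_efcRow_two_mul {m : ℕ} (hm : 1 ≤ m) :
    ∃ i j, 1 ≤ i ∧ efcRow i (j + 1) = 2 * m ∧ efcRow i (j + 2) = 2 * lowerWythoff m + 1 := by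
  induction m using Nat.strong_induction_on with
  | _ m ih =>
    rcases exists_eq_upperWythoff_or_nextHalf hm with ⟨n, hn, rfl⟩ | ⟨n, hn, rfl⟩ | ⟨k, rfl⟩
    · exact ⟨2 * n, 0, by omega, efcFirst_two_mul hn, efcRow_two_mul_two hn⟩
    · exact ⟨2 * n + 1, 0, by omega, efcFirst_two_mul_add_one hn, efcRow_two_mul_add_one_two hn⟩
    · rcases Nat.eq_zero_or_pos k with rfl | hk
      · have h₁ : nextHalf 0 = 1 := by simp [nextHalf, lowerWythoff_zero]
        refine ⟨1, 1, le_rfl, ?_, ?_⟩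
        · rw [efcRow_one_two, h₁]
        · rw [efcRow_add_three 1 0, zero_add, efcRow_one_two, efcRow_one, efcFirst_one, h₁,
            lowerWythoff_one]
      -- Since k < c(k), the entry 2k is already placed, and 2c(k) comes three places after it.
      · obtain ⟨i, j, hi, h₁, h₂⟩ := ih k (by simp only [nextHalf]; omega) hk
        have h₃ := efcRow_add_three i j
        have h₄ : efcRow i (j + 4) = efcRow i (j + 3) + efcRow i (j + 2) := rfl
        have h₅ : efcRow i (j + 5) = efcRow i (j + 4) + efcRow i (j + 3) := rfl
        refine ⟨i, j + 3, hi, ?_, ?_⟩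
        · rw [nextHalf, h₄, h₃]
          omega
        · rw [lowerWythoff_nextHalf, h₅, h₄, h₃]
          omega

theorem exists_efcRow_eq {x : ℕ} (hx : 1 ≤ x) : ∃ i j, 1 ≤ i ∧ efcRow i (j + 1) = x := by
  rcases Nat.even_or_odd' x with ⟨t, rfl | rfl⟩
  · obtain ⟨i, j, hi, h, -⟩ := exists_efcRow_two_mul (by omega : 1 ≤ t)
    exact ⟨i, j, hi, h⟩
  · rcases Nat.eq_zero_or_pos t with rfl | ht
    · exact ⟨1, 0, le_rfl, rfl⟩
    -- 2a(m) + 1 and 2b(m) + 1 are the two entries right after 2m.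
    rcases Xor.or (wythoff_xor ht) with ⟨m, hm, rfl⟩ | ⟨m, hm, rfl⟩
    · obtain ⟨i, j, hi, -, h⟩ := exists_efcRow_two_mul hm
      exact ⟨i, j + 1, hi, h⟩
    · obtain ⟨i, j, hi, h₁, h₂⟩ := exists_efcRow_two_mul hm
      refine ⟨i, j + 2, hi, ?_⟩
      rw [efcRow_add_three, h₁, h₂, upperWythoff]
      ring

theorem IsConsecutive.le {a b : ℕ} (h : IsConsecutive a b) : a ≤ b := by
  cases h with
  | evenOdd m =>
    have h₁ := lt_lowerWythoff_add_one m
    have h₂ := three_halves_lt_goldenRatio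
    have h : (2 * m : ℝ) ≤ 2 * lowerWythoff m + 1 := by
      rcases Nat.eq_zero_or_pos m with rfl | hm
      · simp [lowerWythoff_zero]
      · have : (1 : ℝ) ≤ m := by exact_mod_cast hm
        nlinarith
    exact_mod_cast h
  | oddOdd m => simp only [upperWythoff]; omega
  | oddEven m =>
    have := lowerWythoff_strictMono.le_apply (x := m)
    simp only [upperWythoff, nextHalf]
    omega

theorem efcFirst_le_efcRow {i : ℕ} (hi : 1 ≤ i) (j : ℕ) : efcFirst i ≤ efcRow i (j + 1) := by
  induction j with
  | zero => exact le_rfl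
  | succ j ih => exact ih.trans (isConsecutive_efcRow hi j).le

/-! ### The least-missing-integer rule yields the closed form. -/

theorem firstColumn_efcDelta {i : ℕ} (hi : 1 ≤ i) : firstColumn efcDelta i = efcFirst i := by
  induction i using Nat.strong_induction_on with
  | _ i ih =>
    rw [firstColumn]
    refine IsLeast.csInf_eq ⟨⟨?_, ?_⟩, ?_⟩
    · rcases hi.eq_or_lt with rfl | hi
      · exact le_rfl
      · exact (efcFirst_lt le_rfl hi).le
    · intro i' h hi' j hj
      rw [ih i' h hi']
      exact efcFirst_ne_efcRow hi' h hj
    · rintro x ⟨hx, hx'⟩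
      by_contra! hlt
      obtain ⟨i', j, hi', rfl⟩ := exists_efcRow_eq hx
      -- A row with index at least i has all entries at least `efcFirst i`, hence cannot contain the
      -- smaller x.
      have h : i' < i := by
        by_contra! h
        have h₁ := efcFirst_le_efcRow hi' j
        rcases h.eq_or_lt with rfl | h
        · omega
        · have := efcFirst_lt hi h
          omega
      refine hx' i' h hi' (j + 1) (by omega) ?_
      rw [ih i' h hi']
      rfl

theorem E_one {i : ℕ} (hi : 1 ≤ i) : E i 1 = efcFirst i := firstColumn_efcDelta hi

end Stolarsky

theorem theorem11 :
    (∀ n : ℕ, 1 ≤ n →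
      Stolarsky.E (2 * n) 1 = 2 * ⌊(n : ℝ) * Real.goldenRatio⌋₊ + 2 * n ∧
      Stolarsky.E (2 * n + 1) 1 = 2 * ⌊(n : ℝ) * Real.goldenRatio⌋₊ + 2 * n + 2) ∧
    (∀ n : ℕ, 1 ≤ n → Even (Stolarsky.E (2 * n) 1)) ∧
    (∀ i : ℕ, 2 ≤ i → Even (Stolarsky.E i 1)) := by
  have h : ∀ i : ℕ, 2 ≤ i → Even (Stolarsky.E i 1) := by
    intro i hi
    rw [Stolarsky.E_one (by omega)]
    rcases Stolarsky.eq_one_or_two_mul_or (by omega : 1 ≤ i) with rfl | ⟨n, hn, rfl⟩ | ⟨n, hn, rfl⟩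
    · omega
    · rw [Stolarsky.efcFirst_two_mul hn]
      exact even_two_mul _
    · rw [Stolarsky.efcFirst_two_mul_add_one hn]
      exact even_two_mul _
  refine ⟨fun n hn => ⟨?_, ?_⟩, fun n hn => h _ (by omega), h⟩
  · rw [Stolarsky.E_one (by omega), Stolarsky.efcFirst_two_mul hn]
    exact mul_add 2 _ n
  · rw [Stolarsky.E_one (by omega), Stolarsky.efcFirst_two_mul_add_one hn, mul_add, mul_one]
    exact congrArg (· + 2) (mul_add 2 _ n)
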